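/- Let $\mathcal{H}$ be a complex Hilbert space. For $1\le p<\infty$ let $\mathcal{S}^p$ denote the Schatten--von Neumann class of compact operators $T$ on $\mathcal{H}$ with $\sum_j s_j(T)^p<\infty$, where $s_0(T)\ge s_1(T)\ge\dots$ are the singular values of $T$, and let $\|T\|_p=\big(\sum_j s_j(T)^p\big)^{1/p}$. Let $n\ge 1$ be an integer, let $H$ be a (possibly unbounded) self-adjoint operator densely defined in $\mathcal{H}$, and let $V$ be a bounded self-adjoint operator on $\mathcal{H}$ such that $V(H-iI)^{-1}\in\mathcal{S}^n$. Then there exists a sequence $(V_k)_k$ of bounded self-adjoint finite-rank operators on $\mathcal{H}$ such that $V_k\to V$ strongly, $$\big\|V_k(H-iI)^{-1}-V(H-iI)^{-1}\big\|_n\to 0\quad\text{as }k\to\infty,$$ and, for every $k$, $\|V_k\|\le\|V\|$ and $V_k(H-iI)^{-1}\in\mathcal{S}^n$ with $$\big\|V_k(H-iI)^{-1}\big\|_n\le\big\|V(H-iI)^{-1}\big\|_n.$$ -/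

import Mathlib

open Filter Topology

noncomputable section

namespace RelSchatten

variable {E : Type*} [NormedAddCommGroup E] [InnerProductSpace ℂ E]

/-- The operator `H - iI`, as a linear map on the domain of the (possibly unbounded) operator `H`. -/
def subI (H : E →ₗ.[ℂ] E) : H.domain →ₗ[ℂ] E :=
  H.toFun - Complex.I • H.domain.subtype

theorem subI_apply (H : E →ₗ.[ℂ] E) (x : H.domain) :
    subI H x = H x - Complex.I • (x : E) := rfl

section Resolvent

variable [CompleteSpace E] {H : E →ₗ.[ℂ] E}

theorem symm_of_selfAdjoint (hH : IsSelfAdjoint H) (x y : H.domain) :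
    inner ℂ (H x) (y : E) = inner ℂ (x : E) (H y) := by
  have h := LinearPMap.adjoint_isFormalAdjoint hH.dense_domain
  rw [LinearPMap.isSelfAdjoint_def.1 hH] at h
  exact h x y

theorem im_inner_eq_zero (hH : IsSelfAdjoint H) (x : H.domain) :
    (inner ℂ (x : E) (H x)).im = 0 := by
  have h := symm_of_selfAdjoint hH x x
  rw [← inner_conj_symm] at h
  exact Complex.conj_eq_iff_im.1 h

theorem norm_le_norm_subI (hH : IsSelfAdjoint H) (x : H.domain) :
    ‖(x : E)‖ ≤ ‖subI H x‖ := by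
  have h1 : (inner ℂ (x : E) (subI H x)).im = -‖(x : E)‖ ^ 2 := by
    rw [subI_apply, inner_sub_right, inner_smul_right, inner_self_eq_norm_sq_to_K,
      Complex.sub_im, im_inner_eq_zero hH x, Complex.mul_im]
    simp [← Complex.ofReal_pow]
  have h2 := (Complex.abs_im_le_norm _).trans (norm_inner_le_norm (𝕜 := ℂ) (x : E) (subI H x))
  rw [h1, abs_neg, abs_of_nonneg (by positivity), sq] at h2
  rcases (norm_nonneg (x : E)).eq_or_lt with h0 | h0
  · rw [← h0]; positivity
  · exact le_of_mul_le_mul_left h2 h0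

theorem subI_injective (hH : IsSelfAdjoint H) : Function.Injective (subI H) := by
  rw [injective_iff_map_eq_zero]
  intro x hx
  have h := norm_le_norm_subI hH x
  rw [hx, norm_zero] at h
  exact Subtype.ext (norm_le_zero_iff.1 h)

theorem isClosed_range_subI (hH : IsSelfAdjoint H) :
    IsClosed ((LinearMap.range (subI H) : Submodule ℂ E) : Set E) := by
  refine isClosed_of_closure_subset fun z hz => ?_
  obtain ⟨u, hu, hlim⟩ := mem_closure_iff_seq_limit.1 hz
  choose x hx using hu
  have hc : CauchySeq fun k => (x k : E) := by
    have hu' := hlim.cauchySeq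
    rw [Metric.cauchySeq_iff] at hu' ⊢
    intro ε hε
    obtain ⟨N, hN⟩ := hu' ε hε
    refine ⟨N, fun m hm k hk => lt_of_le_of_lt ?_ (hN m hm k hk)⟩
    rw [dist_eq_norm, dist_eq_norm, ← hx m, ← hx k, ← map_sub]
    exact norm_le_norm_subI hH (x m - x k)
  obtain ⟨a, ha⟩ := cauchySeq_tendsto_of_complete hc
  have hHx : Tendsto (fun k => H (x k)) atTop (𝓝 (z + Complex.I • a)) := by
    refine (hlim.add (ha.const_smul Complex.I)).congr fun k => ?_
    rw [← hx k, subI_apply]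
    abel
  have hg : (a, z + Complex.I • a) ∈ H.graph := by
    have hcl : IsClosed (H.graph : Set (E × E)) := hH.isClosed
    exact hcl.mem_of_tendsto (ha.prodMk_nhds hHx)
      (Eventually.of_forall fun k => LinearPMap.mem_graph H (x k))
  obtain ⟨y, hy1, hy2⟩ := (LinearPMap.mem_graph_iff H).1 hg
  refine ⟨y, ?_⟩
  rw [subI_apply, hy2, hy1]
  exact add_sub_cancel_right z _

theorem subI_surjective (hH : IsSelfAdjoint H) : Function.Surjective (subI H) := by
  have : CompleteSpace (LinearMap.range (subI H)) :=
    (isClosed_range_subI hH).completeSpace_coe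
  rw [← LinearMap.range_eq_top, ← Submodule.orthogonal_eq_bot_iff, Submodule.eq_bot_iff]
  intro y hy
  have hy' : ∀ x : H.domain, inner ℂ (-Complex.I • y) (x : E) = inner ℂ y (H x) := by
    intro x
    have h := Submodule.inner_left_of_mem_orthogonal (LinearMap.mem_range_self (subI H) x) hy
    rw [subI_apply, inner_sub_right, sub_eq_zero, inner_smul_right] at h
    rw [h, inner_smul_left]
    simp
  have hdom := LinearPMap.mem_adjoint_domain_of_exists (T := H) y ⟨_, hy'⟩
  have hsa : LinearPMap.adjoint H = H := LinearPMap.isSelfAdjoint_def.1 hH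
  rw [hsa] at hdom
  have h := symm_of_selfAdjoint hH ⟨y, hdom⟩
  have h1 : H ⟨y, hdom⟩ = -Complex.I • y :=
    hH.dense_domain.eq_of_inner_left ℂ fun v hv => by
      rw [hy' ⟨v, hv⟩]; exact h ⟨v, hv⟩
  have h2 := im_inner_eq_zero hH ⟨y, hdom⟩
  rw [h1, inner_smul_right, inner_self_eq_norm_sq_to_K, Complex.mul_im] at h2
  simpa [← Complex.ofReal_pow] using h2

/-- The resolvent `(H - iI)⁻¹` of a self-adjoint operator `H`, as a bounded operator on the whole
space: the inverse of the bijection `H - iI` from the domain of `H` onto `E`. -/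
def resolventI (H : E →ₗ.[ℂ] E) (hH : IsSelfAdjoint H) : E →L[ℂ] E :=
  LinearMap.mkContinuous
    (H.domain.subtype ∘ₗ
      (LinearEquiv.ofBijective (subI H) ⟨subI_injective hH, subI_surjective hH⟩).symm.toLinearMap)
    1 (fun y => by
      have h := norm_le_norm_subI hH
        ((LinearEquiv.ofBijective (subI H) ⟨subI_injective hH, subI_surjective hH⟩).symm y)
      rw [← LinearEquiv.ofBijective_apply (subI H) (hf := ⟨subI_injective hH, subI_surjective hH⟩),
        LinearEquiv.apply_symm_apply] at h
      simpa using h)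

/-- `(H - iI)⁻¹ (H - iI) x = x` for `x` in the domain of `H`. -/
theorem resolventI_subI (hH : IsSelfAdjoint H) (x : H.domain) :
    resolventI H hH (subI H x) = x :=
  congrArg Subtype.val
    ((LinearEquiv.ofBijective (subI H) ⟨subI_injective hH, subI_surjective hH⟩).symm_apply_apply x)

end Resolvent

/-- The `j`-th singular value (`j = 0, 1, 2, …`, in decreasing order, with multiplicity) of a bounded
operator `T` between Hilbert spaces, as the operator-norm distance from `T` to the operators of rank
at most `j`. For compact `T` this is the `j`-th eigenvalue of `|T|`, or `0` once these run out. -/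
def singularValue (T : E →L[ℂ] E) (j : ℕ) : ℝ :=
  sInf {r : ℝ | ∃ F : E →L[ℂ] E, LinearMap.rank (F : E →ₗ[ℂ] E) ≤ (j : Cardinal) ∧ r = ‖T - F‖}

/-- The Schatten-von Neumann class `𝒮^p`, for `1 ≤ p < ∞`: the compact operators whose sequence of
singular values is `p`-summable. -/
def MemSchatten (p : ℝ) (T : E →L[ℂ] E) : Prop :=
  IsCompactOperator T ∧ Summable fun j => singularValue T j ^ p

/-- The Schatten norm `‖T‖_p = (∑ⱼ sⱼ(T)^p)^(1/p)`; meaningful for `T` in `𝒮^p`. -/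
def schattenNorm (p : ℝ) (T : E →L[ℂ] E) : ℝ :=
  (∑' j, singularValue T j ^ p) ^ (1 / p)

end RelSchatten

end

/-!
Write `R` for the resolvent `(H - i)⁻¹`. It is injective, and normal because the Cayley transform
`1 + 2iR` is unitary (`isStarNormal_resolventI`); these are the only properties of `H` that matter.

The approximants are obtained from two spectral cutoffs, both provided by `exists_spectral_cutoff`.
Cutting `R R⋆` off near `0` gives self-adjoint contractions `A_k` which commute with `R`, factor as
`R Q_k`, and tend strongly to `1` (`exists_approximate_identity`); they play the part of the
spectral projections of `H` onto bounded intervals. Put `K_k = A_k V A_k = A_k (V R) Q_k`, a compact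
self-adjoint operator. Cutting `K_k` off near `0` gives a finite-rank contraction `B_k` commuting
with `K_k`, with `‖B_k K_k - K_k‖ ≤ 1 / (k + 1)`. The approximant is `W_k = B_k K_k`.

Since `A_k` commutes with `R`, we have `W_k R = (B_k A_k) (V R) A_k` with contractions on both
sides of `V R`, so `s_j(W_k R) ≤ s_j(V R)` for every `j`; this gives the bound on Schatten norms.
As `V R` is compact and `A_k → 1` strongly, `W_k R → V R` in operator norm
(`tendsto_norm_compression`). By the Ky Fan inequality
`s_j(W_k R - V R) ≤ 2 s_{⌊j/2⌋}(V R)`, a `p`-summable bound independent of `k`, so dominated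
convergence in `j` turns norm convergence into convergence in `𝒮^p` (`tendsto_schattenNorm_sub`).
Neither the triangle inequality for the Schatten norm nor the spectral theorem for unbounded
operators enters.
-/

namespace RelSchatten

variable {E : Type*} [NormedAddCommGroup E] [InnerProductSpace ℂ E]

/-! ### Approximation numbers -/

theorem bddBelow_approximants (T : E →L[ℂ] E) (j : ℕ) :
    BddBelow {r : ℝ | ∃ F : E →L[ℂ] E,
      LinearMap.rank (F : E →ₗ[ℂ] E) ≤ (j : Cardinal) ∧ r = ‖T - F‖} :=
  ⟨0, by rintro r ⟨F, -, rfl⟩; exact norm_nonneg _⟩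

theorem singularValue_le {T F : E →L[ℂ] E} {j : ℕ}
    (hF : LinearMap.rank (F : E →ₗ[ℂ] E) ≤ (j : Cardinal)) : singularValue T j ≤ ‖T - F‖ :=
  csInf_le (bddBelow_approximants T j) ⟨F, hF, rfl⟩

theorem le_singularValue {T : E →L[ℂ] E} {j : ℕ} {c : ℝ}
    (h : ∀ F : E →L[ℂ] E, LinearMap.rank (F : E →ₗ[ℂ] E) ≤ (j : Cardinal) → c ≤ ‖T - F‖) :
    c ≤ singularValue T j := by
  refine le_csInf ⟨_, 0, ?_, rfl⟩ ?_
  · simp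
  · rintro r ⟨F, hF, rfl⟩
    exact h F hF

theorem singularValue_nonneg (T : E →L[ℂ] E) (j : ℕ) : 0 ≤ singularValue T j :=
  le_singularValue fun _ _ => norm_nonneg _

theorem singularValue_le_norm (T : E →L[ℂ] E) (j : ℕ) : singularValue T j ≤ ‖T‖ := by
  simpa using singularValue_le (T := T) (F := 0) (j := j) (by simp)

theorem singularValue_antitone (T : E →L[ℂ] E) : Antitone (singularValue T) := fun i j hij =>
  le_singularValue fun _ hF => singularValue_le (hF.trans (by exact_mod_cast hij))

/-- Left and right multiplication by contractions does not increase the singular values. -/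
theorem singularValue_comp_comp_le {A B : E →L[ℂ] E} (hA : ‖A‖ ≤ 1) (hB : ‖B‖ ≤ 1)
    (T : E →L[ℂ] E) (j : ℕ) : singularValue (A ∘L T ∘L B) j ≤ singularValue T j := by
  refine le_singularValue fun F hF => ?_
  have hr : LinearMap.rank ((A ∘L F ∘L B : E →L[ℂ] E) : E →ₗ[ℂ] E) ≤ (j : Cardinal) :=
    ((LinearMap.rank_comp_le_right ((F ∘L B : E →L[ℂ] E) : E →ₗ[ℂ] E) (A : E →ₗ[ℂ] E)).trans
      (LinearMap.rank_comp_le_left (B : E →ₗ[ℂ] E) (F : E →ₗ[ℂ] E))).trans hF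
  refine (singularValue_le hr).trans ?_
  have : A ∘L T ∘L B - A ∘L F ∘L B = A ∘L (T - F) ∘L B := by ext; simp
  rw [this]
  calc ‖A ∘L (T - F) ∘L B‖ ≤ ‖A‖ * (‖T - F‖ * ‖B‖) :=
        (A.opNorm_comp_le _).trans (by gcongr; exact (T - F).opNorm_comp_le _)
    _ ≤ 1 * (‖T - F‖ * 1) := by gcongr
    _ = ‖T - F‖ := by ring

/-- The Ky Fan inequality `s_{i+j}(S - T) ≤ s_i(S) + s_j(T)`. -/
theorem singularValue_sub_le (S T : E →L[ℂ] E) (i j : ℕ) :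
    singularValue (S - T) (i + j) ≤ singularValue S i + singularValue T j := by
  rw [← sub_le_iff_le_add]
  refine le_singularValue fun F hF => ?_
  rw [sub_le_comm]
  refine le_singularValue fun G hG => ?_
  rw [sub_le_iff_le_add]
  have hr : LinearMap.rank ((F - G : E →L[ℂ] E) : E →ₗ[ℂ] E) ≤ ((i + j : ℕ) : Cardinal) := by
    have h := LinearMap.rank_add_le (F : E →ₗ[ℂ] E) (-G : E →ₗ[ℂ] E)
    have h2 : LinearMap.rank (-G : E →ₗ[ℂ] E) ≤ (j : Cardinal) := by
      rwa [LinearMap.rank, LinearMap.range_neg]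
    rw [← sub_eq_add_neg] at h
    push_cast
    exact h.trans (add_le_add hF h2)
  refine (singularValue_le hr).trans ?_
  rw [sub_sub_sub_comm, add_comm]
  exact norm_sub_le _ _

theorem summable_comp_half {u : ℕ → ℝ} (hu : Summable u) : Summable fun j => u (j / 2) := by
  have he : HasSum (fun k => u (2 * k / 2)) (∑' k, u k) := by
    simpa using hu.hasSum
  have ho : HasSum (fun k => u ((2 * k + 1) / 2)) (∑' k, u k) := by
    have h : ∀ k : ℕ, (2 * k + 1) / 2 = k := fun k => by omega
    simpa only [h] using hu.hasSum
  exact (HasSum.even_add_odd (f := fun j => u (j / 2)) he ho).summable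

/-- If the singular values of `S` are bounded by those of `T`, those of `S - T` are bounded by a
sequence built from `T` alone in which every value is repeated twice. -/
theorem singularValue_sub_le_half {S T : E →L[ℂ] E}
    (h : ∀ j, singularValue S j ≤ singularValue T j) (j : ℕ) :
    singularValue (S - T) j ≤ 2 * singularValue T (j / 2) := by
  calc singularValue (S - T) j ≤ singularValue (S - T) (j / 2 + j / 2) :=
        singularValue_antitone _ (by omega)
    _ ≤ singularValue S (j / 2) + singularValue T (j / 2) := singularValue_sub_le _ _ _ _
    _ ≤ 2 * singularValue T (j / 2) := by linarith [h (j / 2)]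

/-! ### Schatten classes -/

section Schatten

variable {p : ℝ} {S T : E →L[ℂ] E}

theorem MemSchatten.of_singularValue_le (hp : 0 ≤ p) (hT : MemSchatten p T)
    (hS : IsCompactOperator S) (h : ∀ j, singularValue S j ≤ singularValue T j) :
    MemSchatten p S :=
  ⟨hS, hT.2.of_nonneg_of_le (fun _ => Real.rpow_nonneg (singularValue_nonneg _ _) _)
    fun j => Real.rpow_le_rpow (singularValue_nonneg _ _) (h j) hp⟩

theorem schattenNorm_le_of_singularValue_le (hp : 0 ≤ p) (hT : MemSchatten p T)
    (hS : IsCompactOperator S) (h : ∀ j, singularValue S j ≤ singularValue T j) :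
    schattenNorm p S ≤ schattenNorm p T :=
  Real.rpow_le_rpow (tsum_nonneg fun _ => Real.rpow_nonneg (singularValue_nonneg _ _) _)
    ((hT.of_singularValue_le hp hS h).2.tsum_le_tsum
      (fun j => Real.rpow_le_rpow (singularValue_nonneg _ _) (h j) hp) hT.2)
    (by positivity)

theorem MemSchatten.summable_half (hT : MemSchatten p T) :
    Summable fun j => (2 * singularValue T (j / 2)) ^ p := by
  refine ((summable_comp_half hT.2).mul_left ((2 : ℝ) ^ p)).congr fun j => ?_
  rw [Real.mul_rpow zero_le_two (singularValue_nonneg _ _)]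

theorem MemSchatten.sub_of_singularValue_le (hp : 0 ≤ p) (hT : MemSchatten p T)
    (hS : IsCompactOperator S) (h : ∀ j, singularValue S j ≤ singularValue T j) :
    MemSchatten p (S - T) :=
  ⟨hS.sub hT.1, hT.summable_half.of_nonneg_of_le
    (fun _ => Real.rpow_nonneg (singularValue_nonneg _ _) _)
    fun j => Real.rpow_le_rpow (singularValue_nonneg _ _) (singularValue_sub_le_half h j) hp⟩

/-- Dominated convergence in the Schatten class: convergence in operator norm together with
domination of the singular values gives convergence in `𝒮^p`. -/
theorem tendsto_schattenNorm_sub (hp : 0 < p) (hT : MemSchatten p T) {S : ℕ → E →L[ℂ] E}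
    (h : ∀ k j, singularValue (S k) j ≤ singularValue T j)
    (hlim : Tendsto (fun k => ‖S k - T‖) atTop (𝓝 0)) :
    Tendsto (fun k => schattenNorm p (S k - T)) atTop (𝓝 0) := by
  have key : Tendsto (fun k => ∑' j, singularValue (S k - T) j ^ p) atTop
      (𝓝 (∑' _ : ℕ, (0 : ℝ))) := by
    refine tendsto_tsum_of_dominated_convergence hT.summable_half (fun j => ?_)
      (Eventually.of_forall fun k j => ?_)
    · have h1 : Tendsto (fun k => singularValue (S k - T) j) atTop (𝓝 0) :=
        squeeze_zero (fun k => singularValue_nonneg _ _) (fun k => singularValue_le_norm _ _) hlim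
      simpa [Real.zero_rpow hp.ne'] using h1.rpow_const (p := p) (Or.inr hp.le)
    · rw [Real.norm_of_nonneg (Real.rpow_nonneg (singularValue_nonneg _ _) _)]
      exact Real.rpow_le_rpow (singularValue_nonneg _ _) (singularValue_sub_le_half (h k) j) hp.le
  have hp' : 0 < 1 / p := by positivity
  simpa [schattenNorm, Real.zero_rpow hp'.ne', Real.zero_rpow (inv_pos.2 hp).ne'] using
    key.rpow_const (p := 1 / p) (Or.inr hp'.le)

end Schatten

/-! ### Strong convergence and compact operators -/

/-- A strongly convergent bounded sequence of operators converges uniformly on compact sets, so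
after composition with a compact operator it converges in norm. -/
theorem tendsto_norm_comp_of_isCompactOperator {T : E →L[ℂ] E} (hT : IsCompactOperator T)
    {A : ℕ → E →L[ℂ] E} (hA : ∀ k, ‖A k‖ ≤ 1)
    (hlim : ∀ x, Tendsto (fun k => A k x) atTop (𝓝 x)) :
    Tendsto (fun k => ‖A k ∘L T - T‖) atTop (𝓝 0) := by
  obtain ⟨K, hK, hTK⟩ := IsCompactOperator.image_closedBall_subset_compact (f := (T : E →ₗ[ℂ] E)) hT 1
  rw [Metric.tendsto_atTop]
  intro ε hε
  obtain ⟨t, -, ht, hcov⟩ := hK.finite_cover_balls (e := ε / 6) (by positivity)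
  have hev : ∀ᶠ k in atTop, ∀ y ∈ t, ‖A k y - y‖ < ε / 6 := by
    rw [eventually_all_finite ht]
    intro y _
    have := (hlim y).eventually (Metric.ball_mem_nhds y (ε := ε / 6) (by positivity))
    filter_upwards [this] with k hk
    rwa [dist_eq_norm] at hk
  obtain ⟨N, hN⟩ := eventually_atTop.1 hev
  refine ⟨N, fun k hk => ?_⟩
  rw [Real.dist_0_eq_abs, abs_of_nonneg (norm_nonneg _)]
  refine lt_of_le_of_lt (ContinuousLinearMap.opNorm_le_of_unit_norm (C := ε / 2) (by positivity)
    fun x hx => ?_) (half_lt_self hε)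
  have hmem : T x ∈ K := hTK ⟨x, by simp [hx], rfl⟩
  obtain ⟨y, hy, hxy⟩ := Set.mem_iUnion₂.1 (hcov hmem)
  rw [Metric.mem_ball, dist_eq_norm] at hxy
  have h1 := hN k hk y hy
  have h2 : ‖A k (T x - y)‖ ≤ ‖T x - y‖ := by
    simpa using (A k).le_of_opNorm_le (hA k) (T x - y)
  have h3 : (A k ∘L T - T) x = A k (T x - y) + (A k y - y) - (T x - y) := by
    simp [map_sub]
  rw [h3]
  linarith [norm_sub_le (A k (T x - y) + (A k y - y)) (T x - y),
    norm_add_le (A k (T x - y)) (A k y - y)]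

/-- The fixed vectors of a compact operator form a finite-dimensional space; any operator mapping
into it has finite rank. -/
theorem finiteDimensional_range_of_comp_eq {L F : E →L[ℂ] E} (hL : IsCompactOperator L)
    (h : L * F = F) : FiniteDimensional ℂ (LinearMap.range (F : E →ₗ[ℂ] E)) := by
  let N : Submodule ℂ E := LinearMap.ker ((L - 1 : E →L[ℂ] E) : E →ₗ[ℂ] E)
  have hN : ∀ x, x ∈ N ↔ L x = x := fun x => by simp [N, sub_eq_zero]
  have hcl : IsClosed (N : Set E) := (L - 1).isClosed_ker
  have hmap : ∀ x ∈ N, (L : E →ₗ[ℂ] E) x ∈ N := fun x hx => by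
    have h' : L x = x := (hN x).1 hx
    simpa [h'] using hx
  have hc := IsCompactOperator.restrict (f := (L : E →ₗ[ℂ] E)) hL hmap hcl
  have hidc : ⇑((L : E →ₗ[ℂ] E).restrict hmap) = (id : N → N) := by
    ext x
    exact (hN x).1 x.2
  rw [hidc] at hc
  have : FiniteDimensional ℂ N := .of_isCompactOperator_id (𝕜 := ℂ) hc
  refine Submodule.finiteDimensional_of_le (S₂ := N) ?_
  rintro _ ⟨x, rfl⟩
  exact (hN _).2 (congrArg (fun G : E →L[ℂ] E => G x) h)

variable [CompleteSpace E]

/-- By the C⋆-identity `‖T (A_k - 1)‖² = ‖(A_k - 1) T⋆ T (A_k - 1)‖ ≤ 2 ‖(A_k - 1) T⋆ T‖`, and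
`T⋆ T` is compact, so this reduces to composition on the other side without Schauder's theorem on
the compactness of `T⋆`. -/
theorem tendsto_norm_comp_right_of_isCompactOperator {T : E →L[ℂ] E} (hT : IsCompactOperator T)
    {A : ℕ → E →L[ℂ] E} (hsa : ∀ k, IsSelfAdjoint (A k)) (hA : ∀ k, ‖A k‖ ≤ 1)
    (hlim : ∀ x, Tendsto (fun k => A k x) atTop (𝓝 x)) :
    Tendsto (fun k => ‖T ∘L A k - T‖) atTop (𝓝 0) := by
  have h1 := tendsto_norm_comp_of_isCompactOperator (T := star T * T)
    (hT.clm_comp (star T)) hA hlim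
  have h2 : ∀ k, ‖T ∘L A k - T‖ ^ 2 ≤ ‖A k ∘L (star T * T) - star T * T‖ * 2 := by
    intro k
    change ‖T * A k - T‖ ^ 2 ≤ ‖A k * (star T * T) - star T * T‖ * 2
    have hn : ‖A k - 1‖ ≤ 2 := by
      have := (norm_sub_le (A k) 1).trans (add_le_add (hA k) ContinuousLinearMap.norm_id_le)
      linarith
    rw [sq, ← CStarRing.norm_star_mul_self]
    have : star (T * A k - T) * (T * A k - T) = (A k * (star T * T) - star T * T) * (A k - 1) := by
      rw [star_sub, star_mul, (hsa k).star_eq]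
      noncomm_ring
    rw [this]
    exact (norm_mul_le _ _).trans (by gcongr)
  have h3 : Tendsto (fun k => ‖T ∘L A k - T‖ ^ 2) atTop (𝓝 0) :=
    squeeze_zero (fun k => sq_nonneg _) h2 (by simpa using h1.mul_const 2)
  simpa [Real.sqrt_sq (norm_nonneg _)] using h3.sqrt

theorem tendsto_norm_compression {T : E →L[ℂ] E} (hT : IsCompactOperator T)
    {A : ℕ → E →L[ℂ] E} (hsa : ∀ k, IsSelfAdjoint (A k)) (hA : ∀ k, ‖A k‖ ≤ 1)
    (hlim : ∀ x, Tendsto (fun k => A k x) atTop (𝓝 x)) :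
    Tendsto (fun k => ‖A k ∘L T ∘L A k - T‖) atTop (𝓝 0) := by
  have h1 := (tendsto_norm_comp_right_of_isCompactOperator hT hsa hA hlim).add
    (tendsto_norm_comp_of_isCompactOperator hT hA hlim)
  rw [add_zero] at h1
  refine squeeze_zero (fun k => norm_nonneg _) (fun k => ?_) h1
  have : A k ∘L T ∘L A k - T = A k ∘L (T ∘L A k - T) + (A k ∘L T - T) := by ext; simp
  rw [this]
  refine (norm_add_le _ _).trans (add_le_add_left ?_ _)
  refine ((A k).opNorm_comp_le _).trans ?_
  simpa using mul_le_mul_of_nonneg_right (hA k) (norm_nonneg (T ∘L A k - T))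

/-! ### Spectral cutoff -/

/-- A continuous substitute for the spectral projection of `K` away from `0`. With
`m(x) = max (x², ε²)`, take `B = 1 - ε² / m(K)` and `C = K / m(K)`: then `K C = 1` on the range of
`B`, because `x² / m(x) = 1` wherever `1 - ε² / m(x)` does not vanish. -/
theorem exists_spectral_cutoff {K : E →L[ℂ] E} (hK : IsSelfAdjoint K) {ε : ℝ} (hε : 0 < ε) :
    ∃ B C : E →L[ℂ] E, IsSelfAdjoint B ∧ ‖B‖ ≤ 1 ∧ ‖B * K - K‖ ≤ ε ∧ K * C * B = B ∧
      ∀ D, Commute K D → Commute B D := by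
  have hm : ∀ x : ℝ, 0 < max (x ^ 2) (ε ^ 2) := fun x => lt_max_of_lt_right (by positivity)
  have hm' : ∀ x : ℝ, max (x ^ 2) (ε ^ 2) ≠ 0 := fun x => (hm x).ne'
  let f : ℝ → ℝ := fun x => 1 - ε ^ 2 / max (x ^ 2) (ε ^ 2)
  let u : ℝ → ℝ := fun x => x / max (x ^ 2) (ε ^ 2)
  have hf : Continuous f := by fun_prop (disch := exact hm')
  have hu : Continuous u := by fun_prop (disch := exact hm')
  have hid : cfc (fun x : ℝ => x) K = K := cfc_id' ℝ K
  refine ⟨cfc f K, cfc u K, cfc_predicate f K, norm_cfc_le zero_le_one fun x _ => ?_, ?_, ?_,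
    fun D hD => hD.cfc_real f⟩
  · have h1 : ε ^ 2 / max (x ^ 2) (ε ^ 2) ≤ 1 := (div_le_one (hm x)).2 (le_max_right _ _)
    have h2 : 0 ≤ ε ^ 2 / max (x ^ 2) (ε ^ 2) := by positivity
    rw [Real.norm_eq_abs, abs_le]
    constructor <;> simp only [f] <;> linarith
  · have : cfc f K * K - K = cfc (fun x => f x * x - x) K := by
      rw [cfc_sub (fun x => f x * x) (fun x => x) K (hf.mul continuous_id).continuousOn
        continuous_id.continuousOn, cfc_mul f (fun x => x) K hf.continuousOn
        continuous_id.continuousOn, hid]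
    rw [this]
    refine norm_cfc_le hε.le fun x _ => ?_
    -- `ε² |x| ≤ ε max (x², ε²)`, whichever of `|x|` and `ε` is larger.
    have h1 : f x * x - x = -(ε ^ 2 * x / max (x ^ 2) (ε ^ 2)) := by simp only [f]; ring
    rw [h1, norm_neg, Real.norm_eq_abs, abs_div, abs_of_pos (hm x), div_le_iff₀ (hm x), abs_mul,
      abs_of_pos (by positivity : 0 < ε ^ 2), sq, mul_assoc]
    gcongr
    rcases le_total |x| ε with h | h
    · exact le_max_of_le_right (by nlinarith)
    · exact le_max_of_le_left (by nlinarith [sq_abs x, abs_nonneg x])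
  · have : K * cfc u K * cfc f K = cfc (fun x => x * u x * f x) K := by
      rw [cfc_mul (fun x => x * u x) f K (continuous_id.mul hu).continuousOn hf.continuousOn,
        cfc_mul (fun x => x) u K continuous_id.continuousOn hu.continuousOn, hid]
    rw [this]
    congr 1
    ext x
    simp only [f, u]
    rcases le_total (x ^ 2) (ε ^ 2) with h | h
    · rw [max_eq_right h, div_self (by positivity)]; ring
    · rw [max_eq_left h]
      have hx : x ^ 2 ≠ 0 := (lt_of_lt_of_le (by positivity) h).ne'
      have hx' : x ≠ 0 := by simpa using hx
      field_simp

/-! ### Approximation relative to a normal operator -/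

/-- An injective normal operator admits a bounded sequence of self-adjoint cutoffs that commute
with it, factor through it, and tend strongly to the identity. -/
theorem exists_approximate_identity {R : E →L[ℂ] E} (hR : IsStarNormal R)
    (hinj : Function.Injective R) :
    ∃ A Q : ℕ → E →L[ℂ] E, (∀ k, IsSelfAdjoint (A k)) ∧ (∀ k, ‖A k‖ ≤ 1) ∧
      (∀ k, Commute (A k) R) ∧ (∀ k, R * Q k = A k) ∧
      ∀ x, Tendsto (fun k => A k x) atTop (𝓝 x) := by
  set P : E →L[ℂ] E := R * star R with hPdef
  have hPR : Commute P R := by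
    have := hR.star_comm_self
    exact ((Commute.refl R).mul_left this)
  have hP : IsSelfAdjoint P := IsSelfAdjoint.mul_star_self R
  choose A C hsa hA hlim hAC hcomm using fun k : ℕ =>
    exists_spectral_cutoff hP (ε := 1 / ((k : ℝ) + 1)) (by positivity)
  refine ⟨A, fun k => star R * C k * A k, hsa, hA, fun k => hcomm k R hPR, fun k => ?_, ?_⟩
  · calc R * (star R * C k * A k) = P * C k * A k := by simp only [hPdef, mul_assoc]
      _ = A k := hAC k
  -- `A k → 1` pointwise on the range of `P`, which is dense as `P` is self-adjoint and injective.
  have hPinj : ∀ x, P x = 0 → x = 0 := fun x hx => by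
    have hPs : P = star R * R := hR.star_comm_self.symm
    have h0 : inner ℂ (R x) (R x) = (0 : ℂ) := by
      have : inner ℂ (star R (R x)) x = inner ℂ (R x) (R x) := by
        rw [ContinuousLinearMap.star_eq_adjoint, ContinuousLinearMap.adjoint_inner_left]
      rw [← this]
      have : star R (R x) = P x := by rw [hPs]; rfl
      rw [this, hx, inner_zero_left]
    exact hinj (by rw [inner_self_eq_zero.1 h0, map_zero])
  have hdense : DenseRange P := by
    have htop : (LinearMap.range (P : E →ₗ[ℂ] E)).topologicalClosure = ⊤ := by
      rw [Submodule.topologicalClosure_eq_top_iff, Submodule.eq_bot_iff]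
      intro y hy
      refine hPinj y ?_
      have h0 := Submodule.inner_left_of_mem_orthogonal
        (LinearMap.mem_range_self (P : E →ₗ[ℂ] E) (P y)) hy
      have hs := hP.isSymmetric y (P y)
      simp only [ContinuousLinearMap.coe_coe] at h0 hs
      rw [← hs] at h0
      exact inner_self_eq_zero.1 h0
    have := Submodule.dense_iff_topologicalClosure_eq_top.2 htop
    rwa [LinearMap.coe_range] at this
  intro x
  rw [Metric.tendsto_atTop]
  intro ε hε
  obtain ⟨y, hy⟩ := hdense.exists_dist_lt x (show (0 : ℝ) < ε / 4 by positivity)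
  rw [dist_eq_norm] at hy
  have hto : Tendsto (fun k : ℕ => 1 / ((k : ℝ) + 1) * ‖y‖) atTop (𝓝 0) := by
    simpa using tendsto_one_div_add_atTop_nhds_zero_nat.mul_const ‖y‖
  obtain ⟨N, hN⟩ := eventually_atTop.1 (hto.eventually (gt_mem_nhds (by positivity : 0 < ε / 4)))
  refine ⟨N, fun k hk => ?_⟩
  rw [dist_eq_norm]
  have h1 : ‖A k (P y) - P y‖ ≤ 1 / ((k : ℝ) + 1) * ‖y‖ := by
    simpa using (A k * P - P).le_of_opNorm_le (hlim k) y
  have h2 : ‖A k (x - P y)‖ ≤ ‖x - P y‖ := by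
    simpa using (A k).le_of_opNorm_le (hA k) (x - P y)
  have h3 : A k x - x = A k (x - P y) + (A k (P y) - P y) - (x - P y) := by
    simp [map_sub]
  rw [h3]
  have h4 := hN k hk
  linarith [norm_sub_le (A k (x - P y) + (A k (P y) - P y)) (x - P y),
    norm_add_le (A k (x - P y)) (A k (P y) - P y)]

/-! ### The resolvent -/

section Resolvent

variable {H : E →ₗ.[ℂ] E}

theorem resolventI_injective (hH : IsSelfAdjoint H) : Function.Injective (resolventI H hH) := by
  rw [injective_iff_map_eq_zero]
  intro y hy
  obtain ⟨x, rfl⟩ := subI_surjective hH y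
  rw [resolventI_subI] at hy
  rw [show x = 0 from Subtype.ext hy, map_zero]

/-- The resolvent is normal because the Cayley transform `U = 1 + 2i (H - i)⁻¹ = (H + i)(H - i)⁻¹`
is unitary. -/
theorem isStarNormal_resolventI (hH : IsSelfAdjoint H) : IsStarNormal (resolventI H hH) := by
  set R := resolventI H hH with hRdef
  let U : E →L[ℂ] E := 1 + (2 * Complex.I) • R
  have hU : ∀ x : H.domain, U (subI H x) = H x + Complex.I • (x : E) := fun x => by
    have h : U (subI H x) = subI H x + (2 * Complex.I) • R (subI H x) := rfl
    rw [h, hRdef, resolventI_subI, subI_apply]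
    module
  have hiso : star U * U = 1 := by
    rw [ContinuousLinearMap.star_eq_adjoint]
    refine (ContinuousLinearMap.norm_map_iff_adjoint_comp_self U).1 fun y => ?_
    obtain ⟨x, rfl⟩ := subI_surjective hH y
    rw [hU, subI_apply, ← sq_eq_sq₀ (norm_nonneg _) (norm_nonneg _), @norm_add_sq ℂ,
      @norm_sub_sq ℂ]
    have hs := im_inner_eq_zero hH x
    have : RCLike.re (inner ℂ (H x) (Complex.I • (x : E))) = 0 := by
      rw [inner_smul_right, symm_of_selfAdjoint hH]
      simp [hs]
    rw [this]
    ring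
  have hker : ∀ y, star U y = 0 → y = 0 := fun y hy => by
    -- `y` is orthogonal to the range of `H + i`, so it lies in the domain of `H` with `H y = i y`.
    have hy' : ∀ x : H.domain, inner ℂ (Complex.I • y) (x : E) = inner ℂ y (H x) := by
      intro x
      have h : inner ℂ y (U (subI H x)) = 0 := by
        rw [← ContinuousLinearMap.adjoint_inner_left, ← ContinuousLinearMap.star_eq_adjoint, hy,
          inner_zero_left]
      rw [hU, inner_add_right, inner_smul_right] at h
      rw [inner_smul_left, eq_neg_of_add_eq_zero_left h]
      simp
    have hdom := LinearPMap.mem_adjoint_domain_of_exists (T := H) y ⟨_, hy'⟩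
    rw [LinearPMap.isSelfAdjoint_def.1 hH] at hdom
    have h1 : H ⟨y, hdom⟩ = Complex.I • y :=
      hH.dense_domain.eq_of_inner_left ℂ fun v hv => by
        rw [hy' ⟨v, hv⟩]; exact symm_of_selfAdjoint hH ⟨y, hdom⟩ ⟨v, hv⟩
    have h2 : subI H ⟨y, hdom⟩ = 0 := by rw [subI_apply, h1, sub_self]
    exact congrArg Subtype.val ((map_eq_zero_iff _ (subI_injective hH)).1 h2)
  have hco : U * star U = 1 := by
    ext y
    have h : star U ((U * star U) y - y) = 0 := by
      rw [map_sub]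
      change (star U * U) (star U y) - star U y = 0
      rw [hiso]; simp
    simpa [sub_eq_zero] using hker _ h
  have hUn : Commute (star U) U := by rw [Commute, SemiconjBy, hiso, hco]
  have hRU : R = (2 * Complex.I)⁻¹ • (U - 1) := by
    rw [add_sub_cancel_left, inv_smul_smul₀ (by simp)]
  refine ⟨?_⟩
  rw [hRU, star_smul, star_sub, star_one]
  exact (((hUn.sub_left (Commute.one_left U)).sub_right (Commute.one_right _)).smul_left _).smul_right _

end Resolvent

end RelSchatten

theorem lemma3p9 {E : Type*} [NormedAddCommGroup E] [InnerProductSpace ℂ E] [CompleteSpace E]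
    (n : ℕ) (hn : 1 ≤ n)
    (H : E →ₗ.[ℂ] E) (hH : IsSelfAdjoint H)
    (V : E →L[ℂ] E) (hV : IsSelfAdjoint V)
    (hVH : RelSchatten.MemSchatten n (V ∘L RelSchatten.resolventI H hH)) :
    ∃ W : ℕ → E →L[ℂ] E,
      (∀ k, IsSelfAdjoint (W k)) ∧
      (∀ k, FiniteDimensional ℂ (LinearMap.range (W k : E →ₗ[ℂ] E))) ∧
      (∀ x : E, Tendsto (fun k => W k x) atTop (𝓝 (V x))) ∧
      (∀ k, RelSchatten.MemSchatten n
        (W k ∘L RelSchatten.resolventI H hH - V ∘L RelSchatten.resolventI H hH)) ∧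
      Tendsto (fun k => RelSchatten.schattenNorm n
        (W k ∘L RelSchatten.resolventI H hH - V ∘L RelSchatten.resolventI H hH)) atTop (𝓝 0) ∧
      (∀ k, ‖W k‖ ≤ ‖V‖) ∧
      (∀ k, RelSchatten.MemSchatten n (W k ∘L RelSchatten.resolventI H hH)) ∧
      (∀ k, RelSchatten.schattenNorm n (W k ∘L RelSchatten.resolventI H hH) ≤
        RelSchatten.schattenNorm n (V ∘L RelSchatten.resolventI H hH)) := by
  have hn0 : (0 : ℝ) < n := by exact_mod_cast hn
  have hRn := RelSchatten.isStarNormal_resolventI hH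
  have hRi := RelSchatten.resolventI_injective hH
  set R := RelSchatten.resolventI H hH
  obtain ⟨A, Q, hAsa, hA, hAR, hRQ, hAlim⟩ := RelSchatten.exists_approximate_identity hRn hRi
  let K : ℕ → E →L[ℂ] E := fun k => A k * V * A k
  have hKsa : ∀ k, IsSelfAdjoint (K k) := fun k => by
    simpa [K, (hAsa k).star_eq] using hV.conjugate (A k)
  have hKnorm : ∀ k, ‖K k‖ ≤ ‖V‖ := fun k => by
    calc ‖K k‖ ≤ ‖A k‖ * ‖V‖ * ‖A k‖ :=
          (norm_mul_le _ _).trans (by gcongr; exact norm_mul_le _ _)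
      _ ≤ 1 * ‖V‖ * 1 := by gcongr <;> exact hA k
      _ = ‖V‖ := by ring
  -- `V A_k = (V R) Q_k` is compact since `A_k` factors through the resolvent.
  have hKc : ∀ k, IsCompactOperator (K k) := fun k => by
    have : K k = A k ∘L (V ∘L R) ∘L Q k := by
      change A k * V * A k = A k * (V * R * Q k)
      rw [mul_assoc V, hRQ, mul_assoc]
    rw [this]
    exact (hVH.1.comp_clm (Q k)).clm_comp (A k)
  have hKR : ∀ k, K k ∘L R = A k ∘L (V ∘L R) ∘L A k := fun k => by
    change A k * V * A k * R = A k * (V * R * A k)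
    rw [mul_assoc _ (A k), (hAR k).eq]
    simp only [mul_assoc]
  choose B C hBsa hB hBK hKCB hBcomm using fun k : ℕ =>
    RelSchatten.exists_spectral_cutoff (hKsa k) (ε := 1 / ((k : ℝ) + 1)) (by positivity)
  have hWR : ∀ k, (B k * K k) ∘L R = (B k * A k) ∘L (V ∘L R) ∘L A k := fun k => by
    change B k * K k * R = B k * A k * (V * R * A k)
    have := hKR k
    change K k * R = A k * (V * R * A k) at this
    rw [mul_assoc, this, mul_assoc (B k)]
  have hBA : ∀ k, ‖B k * A k‖ ≤ 1 := fun k =>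
    (norm_mul_le _ _).trans (mul_le_one₀ (hB k) (norm_nonneg _) (hA k))
  have hsv : ∀ k j, RelSchatten.singularValue ((B k * K k) ∘L R) j ≤
      RelSchatten.singularValue (V ∘L R) j := fun k j => by
    rw [hWR]
    exact RelSchatten.singularValue_comp_comp_le (hBA k) (hA k) _ _
  have hWc : ∀ k, IsCompactOperator ((B k * K k) ∘L R) := fun k => by
    rw [hWR]
    exact (hVH.1.comp_clm (A k)).clm_comp (B k * A k)
  have hcut : Tendsto (fun k => ‖B k * K k - K k‖) atTop (𝓝 0) :=
    squeeze_zero (fun _ => norm_nonneg _) hBK tendsto_one_div_add_atTop_nhds_zero_nat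
  refine ⟨fun k => B k * K k, fun k => ?_, fun k => ?_, fun x => ?_, fun k => ?_, ?_, fun k => ?_,
    fun k => ?_, fun k => ?_⟩
  · exact ((hBsa k).commute_iff (hKsa k)).1 (hBcomm k _ (Commute.refl _))
  · refine RelSchatten.finiteDimensional_range_of_comp_eq (L := K k * C k)
      ((hKc k).comp_clm (C k)) ?_
    rw [← mul_assoc, hKCB]
  · have h1 : Tendsto (fun k => A k (V (A k x))) atTop (𝓝 (V x)) := by
      have h2 : Tendsto (fun k => A k (V (A k x) - V x)) atTop (𝓝 0) := by
        have h3 : Tendsto (fun k => ‖V (A k x) - V x‖) atTop (𝓝 0) :=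
          tendsto_iff_norm_sub_tendsto_zero.1 ((V.continuous.tendsto x).comp (hAlim x))
        refine squeeze_zero_norm (fun k => ?_) h3
        simpa using (A k).le_of_opNorm_le (hA k) (V (A k x) - V x)
      simpa using h2.add (hAlim (V x))
    have h4 : Tendsto (fun k => (B k * K k - K k) x) atTop (𝓝 0) :=
      squeeze_zero_norm (fun k => (B k * K k - K k).le_opNorm x)
        (by simpa using hcut.mul_const ‖x‖)
    simpa [K] using h4.add h1
  · exact hVH.sub_of_singularValue_le hn0.le (hWc k) (hsv k)
  · refine RelSchatten.tendsto_schattenNorm_sub hn0 hVH hsv ?_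
    have h1 := (hcut.mul_const ‖R‖).add
      (RelSchatten.tendsto_norm_compression hVH.1 hAsa hA hAlim)
    rw [zero_mul, zero_add] at h1
    refine squeeze_zero (fun _ => norm_nonneg _) (fun k => ?_) h1
    have : (B k * K k) ∘L R - V ∘L R =
        (B k * K k - K k) ∘L R + (A k ∘L (V ∘L R) ∘L A k - V ∘L R) := by
      rw [← hKR, ContinuousLinearMap.sub_comp]; abel
    rw [this]
    exact (norm_add_le _ _).trans (add_le_add_left (ContinuousLinearMap.opNorm_comp_le _ _) _)
  · refine (norm_mul_le _ _).trans ?_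
    simpa using mul_le_mul (hB k) (hKnorm k) (norm_nonneg _) zero_le_one
  · exact hVH.of_singularValue_le hn0.le (hWc k) (hsv k)
  · exact RelSchatten.schattenNorm_le_of_singularValue_le hn0.le hVH (hWc k) (hsv k)
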